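/- Let $\mathbb{CP}^2$ be the complex projective plane, regarded as a smooth manifold of real dimension $4$, with the Fubini–Study form $\omega$ normalized by $\pi^*\omega=\iota^*\Omega_0$. Here $\pi:S^5\to\mathbb{CP}^2$ is the Hopf projection, $\iota:S^5\hookrightarrow\mathbb{C}^3$ is the inclusion of the unit sphere, and $\Omega_0=\frac{i}{2}\sum_{k=0}^{2}du_k\wedge d\bar u_k$ is the standard symplectic form. (With this normalization the total volume of $\mathbb{CP}^2$ is $\pi^2/2$.) Let $$\mathcal{L}_2=\left\{\left[\bar\alpha^2+\bar\beta^2:\sqrt2\,(\bar\alpha\beta-\alpha\bar\beta):\alpha^2+\beta^2\right]\;\middle|\;\alpha,\beta\in\mathbb{C},\ |\alpha|^2+|\beta|^2=1\right\}\subset\mathbb{CP}^2 .$$ Then $\mathcal{L}_2$ is a Lagrangian submanifold of $(\mathbb{CP}^2,\omega)$: it is a smooth embedded submanifold of real dimension $2=\frac12\dim_{\mathbb{R}}\mathbb{CP}^2$, and $\omega_p(u,v)=0$ for all $p\in\mathcal{L}_2$ and all $u,v\in T_p\mathcal{L}_2$. -/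

import Mathlib

open scoped Manifold ContDiff LinearAlgebra.Projectivization Topology
open Set

/-! ### Complex projective space as a smooth manifold -/

/-- Complex projective space `ℂℙⁿ`, the set of complex lines in `ℂⁿ⁺¹`. -/
abbrev CP (n : ℕ) : Type := ℙ ℂ (Fin (n + 1) → ℂ)

namespace CP

variable {n : ℕ}

/-- The quotient topology coming from `ℂⁿ⁺¹ ∖ {0}`. -/
noncomputable instance instTopologicalSpace : TopologicalSpace (CP n) :=
  TopologicalSpace.coinduced (Projectivization.mk' ℂ (V := Fin (n + 1) → ℂ)) inferInstance

/-- The point `[z₀ : ⋯ : zₙ]` with homogeneous coordinates `z`. -/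
noncomputable def pt (z : {z : Fin (n + 1) → ℂ // z ≠ 0}) : CP n := Projectivization.mk ℂ z.1 z.2

lemma isQuotientMap_pt : Topology.IsQuotientMap (pt (n := n)) where
  surjective := fun p => ⟨⟨p.rep, p.rep_nonzero⟩, p.mk_rep⟩
  eq_coinduced := rfl

lemma exists_rep_mk (v : Fin (n + 1) → ℂ) (hv : v ≠ 0) :
    ∃ a : ℂ, a ≠ 0 ∧ ∀ j, (Projectivization.mk ℂ v hv).rep j = a * v j := by
  obtain ⟨a, ha⟩ := Projectivization.exists_smul_eq_mk_rep ℂ v hv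
  refine ⟨a, a.ne_zero, fun j => ?_⟩
  rw [← ha]; rfl

lemma rep_mk_ne_zero_iff (v : Fin (n + 1) → ℂ) (hv : v ≠ 0) (i : Fin (n + 1)) :
    (Projectivization.mk ℂ v hv).rep i ≠ 0 ↔ v i ≠ 0 := by
  obtain ⟨a, ha, h⟩ := exists_rep_mk v hv
  simp [h, ha]

/-- Inhomogeneous coordinates `(z_j / z_i)_{j ≠ i}`. -/
noncomputable def affineCoord (i : Fin (n + 1)) (p : CP n) : Fin n → ℂ :=
  fun j => p.rep (i.succAbove j) / p.rep i

lemma affineCoord_mk (i : Fin (n + 1)) (v : Fin (n + 1) → ℂ) (hv : v ≠ 0) :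
    affineCoord i (Projectivization.mk ℂ v hv) = fun j => v (i.succAbove j) / v i := by
  obtain ⟨a, ha, h⟩ := exists_rep_mk v hv
  funext j
  simp only [affineCoord, h]
  exact mul_div_mul_left _ _ ha

/-- `insertAt i c w` is the vector of `ℂⁿ⁺¹` with `i`-th entry `c` and the other entries,
in order, those of `w`. -/
def insertAt (i : Fin (n + 1)) (c : ℂ) (w : Fin n → ℂ) : Fin (n + 1) → ℂ :=
  Fin.insertNth (α := fun _ => ℂ) i c w

@[simp] lemma insertAt_same (i : Fin (n + 1)) (c : ℂ) (w : Fin n → ℂ) :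
    insertAt i c w i = c := by simp [insertAt]

@[simp] lemma insertAt_succAbove (i : Fin (n + 1)) (c : ℂ) (w : Fin n → ℂ) (j : Fin n) :
    insertAt i c w (i.succAbove j) = w j := by simp [insertAt]

lemma insertAt_one_ne_zero (i : Fin (n + 1)) (w : Fin n → ℂ) : insertAt i 1 w ≠ 0 := fun h => by
  simpa using congrFun h i

lemma contDiff_insertAt (i : Fin (n + 1)) (c : ℂ) : ContDiff ℝ ∞ (insertAt (n := n) i c) := by
  rw [contDiff_pi]
  intro k
  rcases Fin.eq_self_or_eq_succAbove i k with rfl | ⟨j, rfl⟩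
  · simpa using contDiff_const
  · simpa using contDiff_apply ℝ ℂ j

/-- The point with `z_i = 1` and inhomogeneous coordinates `w`. -/
noncomputable def affinePoint (i : Fin (n + 1)) (w : Fin n → ℂ) : CP n :=
  pt ⟨insertAt i 1 w, insertAt_one_ne_zero i w⟩

/-- The `i`-th affine chart of `ℂℙⁿ`, with domain `{z_i ≠ 0}`. -/
noncomputable def affineChart (i : Fin (n + 1)) : OpenPartialHomeomorph (CP n) (Fin n → ℂ) where
  toFun := affineCoord i
  invFun := affinePoint i
  source := {p | p.rep i ≠ 0}
  target := univ
  map_source' _ _ := mem_univ _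
  map_target' w _ := (rep_mk_ne_zero_iff _ _ i).2 (by simp)
  left_inv' p hp := by
    have hp : p.rep i ≠ 0 := hp
    conv_rhs => rw [← p.mk_rep]
    refine (Projectivization.mk_eq_mk_iff' ℂ _ _ _ _).2 ⟨(p.rep i)⁻¹, ?_⟩
    funext k
    rcases Fin.eq_self_or_eq_succAbove i k with rfl | ⟨j, rfl⟩
    · simp [hp]
    · simp [affineCoord, div_eq_inv_mul]
  right_inv' w _ := by
    simp [affinePoint, pt, affineCoord_mk]
  open_source := by
    rw [← isQuotientMap_pt.isOpen_preimage]
    have : pt ⁻¹' {p : CP n | p.rep i ≠ 0} = {z | z.1 i ≠ 0} := by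
      ext z
      exact rep_mk_ne_zero_iff _ _ i
    rw [this]
    exact isOpen_ne_fun ((continuous_apply i).comp continuous_subtype_val) continuous_const
  open_target := isOpen_univ
  continuousOn_toFun := by
    have hs : IsOpen {p : CP n | p.rep i ≠ 0} := by
      rw [← isQuotientMap_pt.isOpen_preimage]
      have : pt ⁻¹' {p : CP n | p.rep i ≠ 0} = {z | z.1 i ≠ 0} := by
        ext z
        exact rep_mk_ne_zero_iff _ _ i
      rw [this]
      exact isOpen_ne_fun ((continuous_apply i).comp continuous_subtype_val) continuous_const
    change ContinuousOn (affineCoord i) _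
    rw [isQuotientMap_pt.continuousOn_isOpen_iff hs]
    refine continuousOn_pi.2 fun j => ?_
    have : ∀ z : {z : Fin (n + 1) → ℂ // z ≠ 0},
        (affineCoord i ∘ pt) z j = z.1 (i.succAbove j) / z.1 i := fun z => by
      simp [pt, affineCoord_mk]
    simp only [this]
    refine ContinuousOn.div ((continuous_apply _).comp continuous_subtype_val).continuousOn
      ((continuous_apply _).comp continuous_subtype_val).continuousOn fun z hz => ?_
    exact (rep_mk_ne_zero_iff _ _ i).1 hz
  continuousOn_invFun := by
    refine Continuous.continuousOn (isQuotientMap_pt.continuous.comp ?_)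
    exact (contDiff_insertAt i 1).continuous.subtype_mk _

lemma exists_rep_ne_zero (p : CP n) : ∃ i, p.rep i ≠ 0 :=
  Function.ne_iff.1 p.rep_nonzero

/-- An index `i` with `z_i ≠ 0`, used to select the preferred affine chart at `p`. -/
noncomputable def chartIndex (p : CP n) : Fin (n + 1) := (exists_rep_ne_zero p).choose

lemma rep_chartIndex_ne_zero (p : CP n) : p.rep (chartIndex p) ≠ 0 :=
  (exists_rep_ne_zero p).choose_spec

noncomputable instance instChartedSpace : ChartedSpace (Fin n → ℂ) (CP n) where
  atlas := range affineChart
  chartAt p := affineChart (chartIndex p)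
  mem_chart_source p := rep_chartIndex_ne_zero p
  chart_mem_atlas _ := mem_range_self _

/-- `ℂℙⁿ` is a smooth real manifold, modelled on the real vector space underlying `ℂⁿ`. -/
instance instIsManifold : IsManifold 𝓘(ℝ, Fin n → ℂ) ∞ (CP n) := by
  refine isManifold_of_contDiffOn _ _ _ ?_
  rintro _ _ ⟨i, rfl⟩ ⟨i', rfl⟩
  have key : ∀ w : Fin n → ℂ, affineCoord i' (affinePoint i w) =
      fun j => insertAt i 1 w (i'.succAbove j) / insertAt i 1 w i' :=
    fun w => affineCoord_mk _ _ _
  have h1 : ContDiffOn ℝ ∞ (fun w : Fin n → ℂ =>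
      fun j => insertAt i 1 w (i'.succAbove j) / insertAt i 1 w i')
      {w | insertAt i 1 w i' ≠ 0} := by
    refine contDiffOn_pi.2 fun j => ?_
    simp only [div_eq_mul_inv]
    exact ContDiffOn.mul ((contDiff_pi.1 (contDiff_insertAt i 1) _).contDiffOn)
      (ContDiffOn.inv ((contDiff_pi.1 (contDiff_insertAt i 1) _).contDiffOn) fun w hw => hw)
  refine (h1.mono ?_).congr fun w _ => key w
  intro w hw
  have : (affinePoint i w).rep i' ≠ 0 := by
    exact hw.1.2
  exact (rep_mk_ne_zero_iff _ _ i').1 this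

/-! ### The Fubini-Study form -/

/-- The standard symplectic form `(i/2) ∑ duₖ ∧ dūₖ` on `ℂᵐ`, i.e. the imaginary part of the
standard hermitian product `h(a, b) = āᵀ b`. -/
noncomputable def stdSymplectic {m : ℕ} (a b : Fin m → ℂ) : ℝ := (star a ⬝ᵥ b).im

/-- The form `(i/2) ∂∂̄ log |z|²` on `ℂⁿ⁺¹ ∖ {0}`, at the point `z`:
`(|z|² Im h(a, b) - Im (h(a, z) h(z, b))) / |z|⁴`. -/
noncomputable def homogeneousForm {m : ℕ} (z a b : Fin m → ℂ) : ℝ :=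
  ((star z ⬝ᵥ z).re * stdSymplectic a b - ((star a ⬝ᵥ z) * (star z ⬝ᵥ b)).im)
    / (star z ⬝ᵥ z).re ^ 2

section Bilinear

variable {m : ℕ} (z a a' b b' : Fin m → ℂ) (c : ℝ)

lemma homogeneousForm_add_left :
    homogeneousForm z (a + a') b = homogeneousForm z a b + homogeneousForm z a' b := by
  simp only [homogeneousForm, stdSymplectic, star_add, add_dotProduct, add_mul, Complex.add_im]
  ring

lemma homogeneousForm_smul_left : homogeneousForm z (c • a) b = c • homogeneousForm z a b := by
  simp only [homogeneousForm, stdSymplectic, star_smul, smul_dotProduct, star_trivial,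
    smul_mul_assoc, Complex.smul_im, smul_eq_mul]
  ring

lemma homogeneousForm_add_right :
    homogeneousForm z a (b + b') = homogeneousForm z a b + homogeneousForm z a b' := by
  simp only [homogeneousForm, stdSymplectic, dotProduct_add, mul_add, Complex.add_im]
  ring

lemma homogeneousForm_smul_right : homogeneousForm z a (c • b) = c • homogeneousForm z a b := by
  simp only [homogeneousForm, stdSymplectic, dotProduct_smul,
    mul_smul_comm, Complex.smul_im, smul_eq_mul]
  ring

lemma insertAt_zero_add (i : Fin (n + 1)) (u v : Fin n → ℂ) :
    insertAt i 0 (u + v) = insertAt i 0 u + insertAt i 0 v := by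
  funext k
  rcases Fin.eq_self_or_eq_succAbove i k with rfl | ⟨j, rfl⟩ <;> simp

lemma insertAt_zero_smul (i : Fin (n + 1)) (u : Fin n → ℂ) :
    insertAt i 0 (c • u) = c • insertAt i 0 u := by
  funext k
  rcases Fin.eq_self_or_eq_succAbove i k with rfl | ⟨j, rfl⟩ <;> simp

end Bilinear

/-- The Fubini-Study form at the point with inhomogeneous coordinates `w` in the `i`-th affine
chart. The section `w ↦ insertAt i 1 w` of `ℂⁿ⁺¹ ∖ {0} → ℂℙⁿ` over this chart has derivative
`u ↦ insertAt i 0 u`, and the form is the pullback of `(i/2) ∂∂̄ log |z|²` by this section, i.e.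
`((1 + |w|²) Im h(u, v) - Im (h(u, w) h(w, v))) / (1 + |w|²)²`. -/
noncomputable def affineForm (i : Fin (n + 1)) (w : Fin n → ℂ) :
    (Fin n → ℂ) →ₗ[ℝ] (Fin n → ℂ) →ₗ[ℝ] ℝ :=
  LinearMap.mk₂ ℝ
    (fun u v => homogeneousForm (insertAt i 1 w) (insertAt i 0 u) (insertAt i 0 v))
    (fun u u' v => by rw [insertAt_zero_add, homogeneousForm_add_left])
    (fun c u v => by rw [insertAt_zero_smul, homogeneousForm_smul_left])
    (fun u v v' => by rw [insertAt_zero_add, homogeneousForm_add_right])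
    (fun c u v => by rw [insertAt_zero_smul, homogeneousForm_smul_right])

/-- The Fubini-Study form on `ℂℙⁿ`, normalized so that it is the reduction of the standard
symplectic form of `ℂⁿ⁺¹` at the unit sphere (see `fubiniStudy_reduction`). A tangent vector
at `p` is given by its coordinates in the preferred chart at `p`. -/
noncomputable def fubiniStudy (n : ℕ) (p : CP n) :
    TangentSpace 𝓘(ℝ, Fin n → ℂ) p →ₗ[ℝ] TangentSpace 𝓘(ℝ, Fin n → ℂ) p →ₗ[ℝ] ℝ :=
  affineForm (chartIndex p) (affineCoord (chartIndex p) p)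

open Classical in
/-- The projection `ℂⁿ⁺¹ ∖ {0} → ℂℙⁿ`, extended by an arbitrary value at `0`. -/
noncomputable def proj (z : Fin (n + 1) → ℂ) : CP n :=
  if hz : z ≠ 0 then Projectivization.mk ℂ z hz else affinePoint 0 0

lemma proj_of_ne_zero {z : Fin (n + 1) → ℂ} (hz : z ≠ 0) :
    proj z = Projectivization.mk ℂ z hz := dif_pos hz

/-- The derivative of the projection at `z`, in the `i`-th affine chart. -/
noncomputable def projDeriv (i : Fin (n + 1)) (z : Fin (n + 1) → ℂ) :
    (Fin (n + 1) → ℂ) →L[ℝ] (Fin n → ℂ) :=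
  ContinuousLinearMap.pi fun j =>
    (z i)⁻¹ • (ContinuousLinearMap.proj (R := ℝ) (φ := fun _ => ℂ) (i.succAbove j)) -
      (z (i.succAbove j) * ((z i) ^ 2)⁻¹) •
        (ContinuousLinearMap.proj (R := ℝ) (φ := fun _ => ℂ) i)

lemma hasFDerivAt_affineCoord_proj (i : Fin (n + 1)) {z : Fin (n + 1) → ℂ} (hz : z ≠ 0)
    (hzi : z i ≠ 0) : HasFDerivAt (affineCoord i ∘ proj) (projDeriv i z) z := by
  have heq : (affineCoord i ∘ proj) =ᶠ[𝓝 z] fun y j => y (i.succAbove j) * (y i)⁻¹ := by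
    filter_upwards [isOpen_ne.mem_nhds hz] with y hy
    funext j
    simp only [Function.comp_apply, proj_of_ne_zero hy, affineCoord_mk, div_eq_mul_inv]
  refine HasFDerivAt.congr_of_eventuallyEq ?_ heq
  rw [hasFDerivAt_pi']
  intro j
  have h1 := hasFDerivAt_apply (𝕜 := ℝ) (F' := fun _ : Fin (n + 1) => ℂ) (i.succAbove j) z
  have h2 := hasFDerivAt_apply (𝕜 := ℝ) (F' := fun _ : Fin (n + 1) => ℂ) i z
  have h3 := (hasFDerivAt_inv' (𝕜 := ℝ) hzi).comp z h2
  refine (h1.mul h3).congr_fderiv ?_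
  ext v
  simp [projDeriv]
  ring

lemma hasMFDerivAt_proj {z : Fin (n + 1) → ℂ} (hz : z ≠ 0) :
    HasMFDerivAt 𝓘(ℝ, Fin (n + 1) → ℂ) 𝓘(ℝ, Fin n → ℂ) proj z
      (projDeriv (chartIndex (proj z)) z) := by
  have hzi : z (chartIndex (proj z)) ≠ 0 := by
    have := rep_chartIndex_ne_zero (proj z)
    generalize chartIndex (proj z) = i at this ⊢
    rw [proj_of_ne_zero hz] at this
    exact (rep_mk_ne_zero_iff _ _ _).1 this
  constructor
  · have h : ContinuousOn (proj (n := n)) {z | z ≠ 0} := by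
      rw [continuousOn_iff_continuous_domRestrict]
      have : Set.domRestrict {z | z ≠ 0} (proj (n := n)) = pt := by
        funext y
        exact proj_of_ne_zero y.2
      rw [this]
      exact isQuotientMap_pt.continuous
    exact h.continuousAt (isOpen_ne.mem_nhds hz)
  · exact (hasFDerivAt_affineCoord_proj _ hz hzi).hasFDerivWithinAt

lemma star_dotProduct_self_im {m : ℕ} (z : Fin m → ℂ) : (star z ⬝ᵥ z).im = 0 := by
  simp only [dotProduct, Complex.im_sum]
  exact Finset.sum_eq_zero fun k _ => by simp; ring

lemma homogeneousForm_basic {m : ℕ} (z a b : Fin m → ℂ) (c s t : ℂ) (hc : c ≠ 0) :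
    homogeneousForm (c • z) (c • a + s • z) (c • b + t • z) = homogeneousForm z a b := by
  have hnum : ∀ z a b : Fin m → ℂ,
      (star z ⬝ᵥ z).re * stdSymplectic a b - ((star a ⬝ᵥ z) * (star z ⬝ᵥ b)).im =
        ((star z ⬝ᵥ z) * (star a ⬝ᵥ b) - (star a ⬝ᵥ z) * (star z ⬝ᵥ b)).im := fun z a b => by
    rw [Complex.sub_im, Complex.mul_im (star z ⬝ᵥ z), star_dotProduct_self_im, stdSymplectic]
    ring
  have hcc : star c * c = ((Complex.normSq c : ℝ) : ℂ) := by
    rw [mul_comm]; exact Complex.mul_conj c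
  have hden : (star (c • z) ⬝ᵥ (c • z)).re = Complex.normSq c * (star z ⬝ᵥ z).re := by
    rw [star_smul, smul_dotProduct, dotProduct_smul, smul_smul, hcc, smul_eq_mul,
      Complex.re_ofReal_mul]
  have hn : Complex.normSq c ≠ 0 := by simpa using hc
  have hmain : (star (c • z) ⬝ᵥ (c • z)) * (star (c • a + s • z) ⬝ᵥ (c • b + t • z)) -
      (star (c • a + s • z) ⬝ᵥ (c • z)) * (star (c • z) ⬝ᵥ (c • b + t • z)) =
      ((Complex.normSq c ^ 2 : ℝ) : ℂ) *
        ((star z ⬝ᵥ z) * (star a ⬝ᵥ b) - (star a ⬝ᵥ z) * (star z ⬝ᵥ b)) := by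
    rw [Complex.ofReal_pow, ← hcc]
    simp only [star_add, star_smul, add_dotProduct, dotProduct_add, smul_dotProduct,
      dotProduct_smul, smul_eq_mul]
    ring
  unfold homogeneousForm
  rw [hnum, hnum, hmain, hden, Complex.im_ofReal_mul, mul_pow]
  exact mul_div_mul_left _ _ (pow_ne_zero 2 hn)

/-- The Fubini-Study form pulls back to `(i/2) ∂∂̄ log |z|²` on `ℂⁿ⁺¹ ∖ {0}`; in particular it
does not depend on the choice of charts. -/
theorem fubiniStudy_mfderiv_proj {z : Fin (n + 1) → ℂ} (hz : z ≠ 0) (a b : Fin (n + 1) → ℂ) :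
    fubiniStudy n (proj z) (mfderiv 𝓘(ℝ, Fin (n + 1) → ℂ) 𝓘(ℝ, Fin n → ℂ) proj z a)
      (mfderiv 𝓘(ℝ, Fin (n + 1) → ℂ) 𝓘(ℝ, Fin n → ℂ) proj z b) = homogeneousForm z a b := by
  rw [(hasMFDerivAt_proj hz).mfderiv]
  have hzi : z (chartIndex (proj z)) ≠ 0 := by
    have := rep_chartIndex_ne_zero (proj z)
    generalize chartIndex (proj z) = i at this ⊢
    rw [proj_of_ne_zero hz] at this
    exact (rep_mk_ne_zero_iff _ _ _).1 this
  change affineForm _ (affineCoord _ (proj z)) (projDeriv _ z a) (projDeriv _ z b) = _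
  generalize chartIndex (proj z) = i at hzi ⊢
  rw [proj_of_ne_zero hz, affineCoord_mk]
  have hd : ∀ a : Fin (n + 1) → ℂ, insertAt i 0 (projDeriv i z a) =
      (z i)⁻¹ • a + (-(a i * ((z i) ^ 2)⁻¹)) • z := fun a => by
    funext k
    rcases Fin.eq_self_or_eq_succAbove i k with rfl | ⟨j, rfl⟩
    · simp only [insertAt_same, Pi.add_apply, Pi.smul_apply, smul_eq_mul]
      field_simp
      ring
    · simp only [insertAt_succAbove, Pi.add_apply, Pi.smul_apply, smul_eq_mul]
      simp [projDeriv]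
      ring
  have hp : insertAt i 1 (fun j => z (i.succAbove j) / z i) = (z i)⁻¹ • z := by
    funext k
    rcases Fin.eq_self_or_eq_succAbove i k with rfl | ⟨j, rfl⟩
    · simp [hzi]
    · simp [div_eq_inv_mul]
  change homogeneousForm (insertAt i 1 _) (insertAt i 0 _) (insertAt i 0 _) = _
  rw [hd, hd, hp]
  exact homogeneousForm_basic _ _ _ _ _ _ (inv_ne_zero hzi)

/-- The Fubini-Study form is the reduction of the standard symplectic form: its pullback to the
unit sphere `S²ⁿ⁺¹` is the restriction of the standard symplectic form of `ℂⁿ⁺¹`. -/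
theorem fubiniStudy_reduction {z : Fin (n + 1) → ℂ} (hz : star z ⬝ᵥ z = 1)
    {a b : Fin (n + 1) → ℂ} (ha : (star a ⬝ᵥ z).re = 0) (hb : (star z ⬝ᵥ b).re = 0) :
    fubiniStudy n (proj z) (mfderiv 𝓘(ℝ, Fin (n + 1) → ℂ) 𝓘(ℝ, Fin n → ℂ) proj z a)
      (mfderiv 𝓘(ℝ, Fin (n + 1) → ℂ) 𝓘(ℝ, Fin n → ℂ) proj z b) = stdSymplectic a b := by
  have h0 : z ≠ 0 := by
    rintro rfl
    simp at hz
  rw [fubiniStudy_mfderiv_proj h0, homogeneousForm, Complex.mul_im, ha, hb, hz]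
  simp

end CP

/-! ### Lagrangian submanifolds -/

section Lagrangian

variable {E : Type*} [NormedAddCommGroup E] [NormedSpace ℝ E] [FiniteDimensional ℝ E]
  {M : Type*} [TopologicalSpace M] [ChartedSpace E M]

/-- `L` is a smooth embedded `k`-dimensional submanifold of `M`: around each of its points there
is a smooth chart of `M` in which `L` is a `k`-dimensional linear subspace. -/
def IsEmbeddedSubmanifold (E : Type*) [NormedAddCommGroup E] [NormedSpace ℝ E]
    {M : Type*} [TopologicalSpace M] [ChartedSpace E M] (k : ℕ) (L : Set M) : Prop :=
  ∀ p ∈ L, ∃ φ ∈ IsManifold.maximalAtlas 𝓘(ℝ, E) ∞ M, p ∈ φ.source ∧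
    ∃ F : Submodule ℝ E, Module.finrank ℝ F = k ∧
      ∀ q ∈ φ.source, q ∈ L ↔ φ q ∈ F

/-- The vectors of `T_p M` tangent to `L` at `p`: the velocities at time `0` of smooth curves
in `M` which start at `p` and stay in `L`. For an embedded submanifold `L` this is `T_p L`. -/
def tangentVectors (E : Type*) [NormedAddCommGroup E] [NormedSpace ℝ E]
    {M : Type*} [TopologicalSpace M] [ChartedSpace E M] (L : Set M) (p : M) :
    Set (TangentSpace 𝓘(ℝ, E) p) :=
  {v | ∃ γ : ℝ → M, ContMDiffAt 𝓘(ℝ, ℝ) 𝓘(ℝ, E) ∞ γ 0 ∧ (∀ᶠ t in 𝓝 0, γ t ∈ L) ∧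
    (⟨γ 0, mfderiv 𝓘(ℝ, ℝ) 𝓘(ℝ, E) γ 0 (1 : ℝ)⟩ : TangentBundle 𝓘(ℝ, E) M) = ⟨p, v⟩}

/-- `L` is a Lagrangian submanifold of `M` with respect to the (symplectic) form `Ω`: it is an
embedded submanifold of half the dimension of `M`, and `Ω` vanishes on each of its
tangent spaces. -/
structure IsLagrangianSubmanifold
    (Ω : ∀ p : M, TangentSpace 𝓘(ℝ, E) p →ₗ[ℝ] TangentSpace 𝓘(ℝ, E) p →ₗ[ℝ] ℝ)
    (L : Set M) : Prop where
  submanifold : ∃ k : ℕ, 2 * k = Module.finrank ℝ E ∧ IsEmbeddedSubmanifold E k L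
  isotropic : ∀ p ∈ L, ∀ u ∈ tangentVectors E L p, ∀ v ∈ tangentVectors E L p, Ω p u v = 0

end Lagrangian

/-! ### The set `𝓛₂` -/

open ComplexConjugate in
/-- The vector `(ᾱ² + β̄², √2 (ᾱ β - α β̄), α² + β²)` of `ℂ³`. -/
noncomputable def lagVector (α β : ℂ) : Fin 3 → ℂ :=
  ![conj α ^ 2 + conj β ^ 2, (√2 : ℝ) * (conj α * β - α * conj β), α ^ 2 + β ^ 2]

lemma lagVector_ne_zero {α β : ℂ} (h : ‖α‖ ^ 2 + ‖β‖ ^ 2 = 1) : lagVector α β ≠ 0 := by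
  intro h0
  have h1 : α ^ 2 + β ^ 2 = 0 := by simpa [lagVector] using congrFun h0 2
  have h2 : starRingEnd ℂ α * β - α * starRingEnd ℂ β = 0 := by
    simpa [lagVector] using congrFun h0 1
  rw [← Complex.normSq_eq_norm_sq, ← Complex.normSq_eq_norm_sq] at h
  obtain ⟨a, b⟩ := α
  obtain ⟨c, d⟩ := β
  simp only [Complex.ext_iff, Complex.normSq_apply, pow_two, Complex.add_re, Complex.mul_re,
    Complex.add_im, Complex.mul_im, Complex.sub_re, Complex.sub_im, Complex.conj_re,
    Complex.conj_im, Complex.zero_re, Complex.zero_im] at h h1 h2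
  have key : (a * a + b * b + (c * c + d * d)) ^ 2 =
      (a * a - b * b + (c * c - d * d)) ^ 2 + (a * b + b * a + (c * d + d * c)) ^ 2 +
      (a * d + -b * c - (a * -d + b * c)) ^ 2 := by ring
  rw [h, h1.1, h1.2, h2.2] at key
  norm_num at key

/-- The subset `𝓛₂` of `ℂℙ²`. -/
def lagL2 : Set (CP 2) :=
  {p | ∃ (α β : ℂ) (h : ‖α‖ ^ 2 + ‖β‖ ^ 2 = 1),
    p = Projectivization.mk ℂ (lagVector α β) (lagVector_ne_zero h)}

/-! ### Smoothness of the projection and of projective linear maps -/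

namespace CP

variable {n : ℕ}

/-! The set `lagL2` is a linearly embedded real projective plane. Put `w = α² + β²` and `t = 2 Im (ᾱ
β)`. The defining vector is `(w̄, i √2 t, w)`, which is the image under the complex automorphism
`lagFrame` of the real vector `(Re w, Im w, √2 t)`. Since `|w|² + t² = 1`, these real vectors lie on
an ellipsoid around the origin, and by `exists_lag_parameters` they fill it. Every real line meets
the ellipsoid, so `lagL2` is the image of `lagFrame (ℝ³)`; this is `lagL2_eq_realProjective`.

The rest holds for any automorphism `e` of `ℂⁿ⁺¹` whose real subspace `e (ℝⁿ⁺¹)` has real hermitian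
products (`isLagrangianSubmanifold_realProjective`). In the affine charts adapted to `e`, the image
of `e (ℝⁿ⁺¹)` is `ℝⁿ ⊂ ℂⁿ`, hence an embedded submanifold of half the dimension. Its tangent vectors
are projections of vectors of `e (ℝⁿ⁺¹)`, and on these the pulled-back form `homogeneousForm`
involves only imaginary parts of real numbers. For `lagFrame` the hermitian products are real by
`lagFrame_isotropic`. -/

lemma affineChart_mem_maximalAtlas (i : Fin (n + 1)) :
    affineChart i ∈ IsManifold.maximalAtlas 𝓘(ℝ, Fin n → ℂ) ∞ (CP n) :=
  IsManifold.subset_maximalAtlas (mem_range_self i)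

lemma affinePoint_eq_proj (i : Fin (n + 1)) (w : Fin n → ℂ) :
    affinePoint i w = proj (insertAt i 1 w) :=
  (proj_of_ne_zero (insertAt_one_ne_zero i w)).symm

lemma proj_smul {c : ℂ} (hc : c ≠ 0) {z : Fin (n + 1) → ℂ} (hz : z ≠ 0) :
    proj (c • z) = proj z := by
  rw [proj_of_ne_zero hz, proj_of_ne_zero (smul_ne_zero hc hz)]
  exact (Projectivization.mk_eq_mk_iff' ℂ _ _ _ _).2 ⟨c, rfl⟩

lemma affinePoint_affineCoord {i : Fin (n + 1)} {p : CP n} (hp : p.rep i ≠ 0) :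
    affinePoint i (affineCoord i p) = p :=
  (affineChart i).left_inv hp

/-- Where `z i ≠ 0`, the projection is the smooth map of coordinate ratios followed by the inverse
of the `i`-th affine chart. -/
lemma contMDiffAt_proj {z : Fin (n + 1) → ℂ} (hz : z ≠ 0) :
    ContMDiffAt 𝓘(ℝ, Fin (n + 1) → ℂ) 𝓘(ℝ, Fin n → ℂ) ∞ proj z := by
  obtain ⟨i, hi⟩ : ∃ i, z i ≠ 0 := Function.ne_iff.1 hz
  have hc : ContMDiffAt 𝓘(ℝ, Fin (n + 1) → ℂ) 𝓘(ℝ, Fin n → ℂ) ∞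
      (fun y : Fin (n + 1) → ℂ => fun j : Fin n => y (i.succAbove j) * (y i)⁻¹) z :=
    ContDiffAt.contMDiffAt <| contDiffAt_pi.2 fun j =>
      (contDiff_apply ℝ ℂ _).contDiffAt.mul ((contDiff_apply ℝ ℂ i).contDiffAt.inv hi)
  have hs : ContMDiffAt 𝓘(ℝ, Fin n → ℂ) 𝓘(ℝ, Fin n → ℂ) ∞ (affinePoint i)
      (fun j : Fin n => z (i.succAbove j) * (z i)⁻¹) :=
    (contMDiffOn_symm_of_mem_maximalAtlas (affineChart_mem_maximalAtlas i)).contMDiffAt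
      Filter.univ_mem
  refine (hs.comp z hc).congr_of_eventuallyEq ?_
  filter_upwards [(isOpen_ne_fun (continuous_apply i) continuous_const).mem_nhds hi] with y hy
  have hy0 : y ≠ 0 := fun h => hy (congrFun h i)
  have := affinePoint_affineCoord (i := i) (p := proj y) (by
    rw [proj_of_ne_zero hy0]
    exact (rep_mk_ne_zero_iff _ _ i).2 hy)
  rw [← this, proj_of_ne_zero hy0, affineCoord_mk]
  simp only [Function.comp_apply, div_eq_mul_inv]

/-- The action of an injective linear map of `ℂⁿ⁺¹` on `ℂℙⁿ` is smooth. -/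
lemma contMDiff_map (f : (Fin (n + 1) → ℂ) →ₗ[ℂ] (Fin (n + 1) → ℂ)) (hf : Function.Injective f) :
    ContMDiff 𝓘(ℝ, Fin n → ℂ) 𝓘(ℝ, Fin n → ℂ) ∞ (Projectivization.map f hf : CP n → CP n) := by
  intro p
  set i := chartIndex p
  have hp : p ∈ (affineChart i).source := rep_chartIndex_ne_zero p
  have h1 : ContMDiffAt 𝓘(ℝ, Fin n → ℂ) 𝓘(ℝ, Fin n → ℂ) ∞ (affineCoord i) p :=
    contMDiffAt_of_mem_maximalAtlas (affineChart_mem_maximalAtlas i) hp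
  have h2 : ContMDiffAt 𝓘(ℝ, Fin n → ℂ) 𝓘(ℝ, Fin (n + 1) → ℂ) ∞
      (fun w : Fin n → ℂ => f (insertAt i 1 w)) (affineCoord i p) := by
    refine ContMDiff.contMDiffAt (ContDiff.contMDiff ?_)
    exact ((f.toContinuousLinearMap.restrictScalars ℝ).contDiff).comp (contDiff_insertAt i 1)
  have hne : ∀ w, f (insertAt i 1 w) ≠ 0 := fun w h =>
    insertAt_one_ne_zero i w (hf (h.trans (map_zero f).symm))
  -- Near `p` the induced map is: affine coordinates, lift to the slice with `i`-th entry 1, apply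
  -- `f`, project.
  have h3 := (contMDiffAt_proj (hne (affineCoord i p))).comp p (h2.comp p h1)
  refine h3.congr_of_eventuallyEq ?_
  filter_upwards [(affineChart i).open_source.mem_nhds hp] with q hq
  conv_lhs => rw [← affinePoint_affineCoord hq]
  exact (proj_of_ne_zero (hne _)).symm

/-- The diffeomorphism of `ℂℙⁿ` induced by a linear automorphism of `ℂⁿ⁺¹`. -/
noncomputable def mapDiffeomorph (e : (Fin (n + 1) → ℂ) ≃ₗ[ℂ] (Fin (n + 1) → ℂ)) :
    Diffeomorph 𝓘(ℝ, Fin n → ℂ) 𝓘(ℝ, Fin n → ℂ) (CP n) (CP n) ∞ where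
  toFun := Projectivization.map e.toLinearMap e.injective
  invFun := Projectivization.map e.symm.toLinearMap e.symm.injective
  left_inv p := by
    induction p using Projectivization.ind with
    | h v hv => simp [Projectivization.map_mk]
  right_inv p := by
    induction p using Projectivization.ind with
    | h v hv => simp [Projectivization.map_mk]
  contMDiff_toFun := contMDiff_map e.toLinearMap e.injective
  contMDiff_invFun := contMDiff_map e.symm.toLinearMap e.symm.injective

lemma mapDiffeomorph_proj (e : (Fin (n + 1) → ℂ) ≃ₗ[ℂ] (Fin (n + 1) → ℂ))
    {z : Fin (n + 1) → ℂ} (hz : z ≠ 0) : mapDiffeomorph e (proj z) = proj (e z) := by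
  rw [proj_of_ne_zero hz, proj_of_ne_zero (e.map_ne_zero_iff.2 hz)]
  rfl

lemma mapDiffeomorph_symm_proj (e : (Fin (n + 1) → ℂ) ≃ₗ[ℂ] (Fin (n + 1) → ℂ))
    {z : Fin (n + 1) → ℂ} (hz : z ≠ 0) : (mapDiffeomorph e).symm (proj (e z)) = proj z := by
  rw [← mapDiffeomorph_proj e hz, Diffeomorph.symm_apply_apply]

/-! ### Affine charts in linear coordinates -/

/-- The affine chart of `ℂℙⁿ` in the linear coordinates given by `e`. -/
noncomputable def linearChart (e : (Fin (n + 1) → ℂ) ≃ₗ[ℂ] (Fin (n + 1) → ℂ)) (i : Fin (n + 1)) :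
    OpenPartialHomeomorph (CP n) (Fin n → ℂ) :=
  (mapDiffeomorph e).symm.toHomeomorph.toOpenPartialHomeomorph.trans (affineChart i)

/-- `IsEmbeddedSubmanifold` admits any chart of the maximal atlas, so the chart can be adapted to
`e`; a diffeomorphism followed by a chart is such a chart. -/
lemma linearChart_mem_maximalAtlas (e : (Fin (n + 1) → ℂ) ≃ₗ[ℂ] (Fin (n + 1) → ℂ))
    (i : Fin (n + 1)) :
    linearChart e i ∈ IsManifold.maximalAtlas 𝓘(ℝ, Fin n → ℂ) ∞ (CP n) := by
  rw [IsManifold.mem_maximalAtlas_iff_contMDiffOn]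
  constructor
  · exact (contMDiffOn_of_mem_maximalAtlas (affineChart_mem_maximalAtlas i)).comp
      (mapDiffeomorph e).symm.contMDiff.contMDiffOn fun q hq => hq.2
  · exact (mapDiffeomorph e).contMDiff.comp_contMDiffOn
      ((contMDiffOn_symm_of_mem_maximalAtlas (affineChart_mem_maximalAtlas i)).mono
        fun _ _ => mem_univ _)

lemma mem_linearChart_source (e : (Fin (n + 1) → ℂ) ≃ₗ[ℂ] (Fin (n + 1) → ℂ)) (i : Fin (n + 1))
    {z : Fin (n + 1) → ℂ} (hz : z ≠ 0) : proj (e z) ∈ (linearChart e i).source ↔ z i ≠ 0 := by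
  have : proj (e z) ∈ (linearChart e i).source ↔
      ((mapDiffeomorph e).symm (proj (e z))).rep i ≠ 0 := by
    simp [linearChart, affineChart]
  rw [this, mapDiffeomorph_symm_proj e hz, proj_of_ne_zero hz, rep_mk_ne_zero_iff]

lemma linearChart_proj (e : (Fin (n + 1) → ℂ) ≃ₗ[ℂ] (Fin (n + 1) → ℂ)) (i : Fin (n + 1))
    {z : Fin (n + 1) → ℂ} (hz : z ≠ 0) :
    linearChart e i (proj (e z)) = fun j => z (i.succAbove j) / z i := by
  change affineCoord i ((mapDiffeomorph e).symm (proj (e z))) = _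
  rw [mapDiffeomorph_symm_proj e hz, proj_of_ne_zero hz, affineCoord_mk]

lemma linearChart_symm_apply (e : (Fin (n + 1) → ℂ) ≃ₗ[ℂ] (Fin (n + 1) → ℂ)) (i : Fin (n + 1))
    (w : Fin n → ℂ) : (linearChart e i).symm w = proj (e (insertAt i 1 w)) := by
  change mapDiffeomorph e (affinePoint i w) = _
  rw [affinePoint_eq_proj, mapDiffeomorph_proj e (insertAt_one_ne_zero i w)]

/-! ### Images of totally real subspaces -/

/-- The real subspace of vectors with real entries. -/
def realPart (m : ℕ) : Submodule ℝ (Fin m → ℂ) where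
  carrier := {w | ∀ j, (w j).im = 0}
  add_mem' ha hb j := by simp [ha j, hb j]
  zero_mem' j := by simp
  smul_mem' c w hw j := by simp [hw j]

lemma mem_realPart {m : ℕ} {w : Fin m → ℂ} : w ∈ realPart m ↔ ∀ j, (w j).im = 0 := Iff.rfl

lemma finrank_realPart (m : ℕ) : Module.finrank ℝ (realPart m) = m := by
  let f : (Fin m → ℝ) →ₗ[ℝ] (Fin m → ℂ) := Complex.ofRealLI.toLinearMap.compLeft (Fin m)
  have hf : Function.Injective f := fun x y h => by
    funext j
    simpa [f] using congrFun h j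
  have hr : realPart m = LinearMap.range f := by
    ext w
    constructor
    · intro hw
      refine ⟨fun j => (w j).re, ?_⟩
      funext j
      apply Complex.ext <;> simp [f, mem_realPart.1 hw j]
    · rintro ⟨x, rfl⟩ j
      simp [f]
  rw [hr, LinearMap.finrank_range_of_inj hf, Module.finrank_fin_fun]

lemma isClosed_realPart (m : ℕ) : IsClosed (realPart m : Set (Fin m → ℂ)) :=
  Submodule.closed_of_finiteDimensional _

/-- The image in `ℂℙⁿ` of the totally real subspace `e(ℝⁿ⁺¹)`. -/
def realProjective (e : (Fin (n + 1) → ℂ) ≃ₗ[ℂ] (Fin (n + 1) → ℂ)) : Set (CP n) :=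
  {p | ∃ x ∈ realPart (n + 1), x ≠ 0 ∧ p = proj (e x)}

lemma insertAt_mem_realPart {i : Fin (n + 1)} {c : ℂ} (hc : c.im = 0) {w : Fin n → ℂ}
    (hw : w ∈ realPart n) : insertAt i c w ∈ realPart (n + 1) := by
  intro k
  rcases Fin.eq_self_or_eq_succAbove i k with rfl | ⟨j, rfl⟩
  · simpa using hc
  · simpa using hw j

/-- Ratios of real coordinates are real; conversely, real ratios give a real representative with
`i`-th entry 1. -/
lemma mem_realProjective_iff (e : (Fin (n + 1) → ℂ) ≃ₗ[ℂ] (Fin (n + 1) → ℂ)) (i : Fin (n + 1))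
    {q : CP n} (hq : q ∈ (linearChart e i).source) :
    q ∈ realProjective e ↔ linearChart e i q ∈ realPart n := by
  constructor
  · rintro ⟨x, hx, hx0, rfl⟩ j
    rw [linearChart_proj e i hx0, Complex.div_im, hx, hx]
    simp
  · intro h
    refine ⟨insertAt i 1 (linearChart e i q), insertAt_mem_realPart (by simp) h,
      insertAt_one_ne_zero _ _, ?_⟩
    rw [← linearChart_symm_apply, (linearChart e i).left_inv hq]

lemma isEmbeddedSubmanifold_realProjective (e : (Fin (n + 1) → ℂ) ≃ₗ[ℂ] (Fin (n + 1) → ℂ)) :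
    IsEmbeddedSubmanifold (Fin n → ℂ) n (realProjective e) := by
  rintro _ ⟨x, -, hx0, rfl⟩
  obtain ⟨i, hi⟩ : ∃ i, x i ≠ 0 := Function.ne_iff.1 hx0
  exact ⟨linearChart e i, linearChart_mem_maximalAtlas e i, (mem_linearChart_source e i hx0).2 hi,
    realPart n, finrank_realPart n, fun q hq => mem_realProjective_iff e i hq⟩

/-! ### Tangent vectors and isotropy -/

/-- The derivative at an interior point of a curve which stays in a closed subspace lies in
that subspace. -/
lemma _root_.HasDerivAt.mem_of_eventually_mem {E : Type*} [NormedAddCommGroup E] [NormedSpace ℝ E]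
    {F : Submodule ℝ E} (hF : IsClosed (F : Set E)) {c : ℝ → E} {c' : E} {t : ℝ}
    (hc : HasDerivAt c c' t) (hcF : ∀ᶠ s in 𝓝 t, c s ∈ F) : c' ∈ F := by
  refine hF.mem_of_tendsto hc.tendsto_slope ?_
  filter_upwards [hcF.filter_mono nhdsWithin_le_nhds] with s hs
  exact F.smul_mem _ (F.sub_mem hs hcF.self_of_nhds)

/-- A curve in the real projective space has real coordinates `c t` in the adapted chart, so it
lifts to the curve `e (insertAt i 1 (c t))` in `e (ℝⁿ⁺¹)`. The velocity of the lift is again in `e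
(ℝⁿ⁺¹)` and projects to `v`. -/
lemma exists_eq_mfderiv_proj_of_mem_tangentVectors (e : (Fin (n + 1) → ℂ) ≃ₗ[ℂ] (Fin (n + 1) → ℂ))
    {i : Fin (n + 1)} {w : Fin n → ℂ}
    {v : TangentSpace 𝓘(ℝ, Fin n → ℂ) (proj (e (insertAt i 1 w)))}
    (hv : v ∈ tangentVectors (Fin n → ℂ) (realProjective e) (proj (e (insertAt i 1 w)))) :
    ∃ a ∈ realPart (n + 1),
      v = mfderiv 𝓘(ℝ, Fin (n + 1) → ℂ) 𝓘(ℝ, Fin n → ℂ) proj (e (insertAt i 1 w)) (e a) := by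
  obtain ⟨γ, hγ, hL, h⟩ := hv
  have h0 : γ 0 = proj (e (insertAt i 1 w)) := congrArg (fun x => x.1) h
  -- All fibres of the tangent bundle are definitionally `Fin n → ℂ`, so the vectors can be compared
  -- although their base points `γ 0` and `proj (e (insertAt i 1 w))` are only propositionally
  -- equal.
  have h1 : (mfderiv 𝓘(ℝ, ℝ) 𝓘(ℝ, Fin n → ℂ) γ 0 (1 : ℝ) : Fin n → ℂ) = v :=
    congrArg (fun x : TangentBundle 𝓘(ℝ, Fin n → ℂ) (CP n) => (x.2 : Fin n → ℂ)) h
  have hne : ∀ w : Fin n → ℂ, e (insertAt i 1 w) ≠ 0 := fun w =>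
    e.map_ne_zero_iff.2 (insertAt_one_ne_zero i w)
  have hsrc : γ 0 ∈ (linearChart e i).source := by
    rw [h0, mem_linearChart_source e i (insertAt_one_ne_zero i w)]
    simp
  have hsrc' : ∀ᶠ t in 𝓝 0, γ t ∈ (linearChart e i).source :=
    hγ.continuousAt.eventually_mem ((linearChart e i).open_source.mem_nhds hsrc)
  set c : ℝ → Fin n → ℂ := fun t => linearChart e i (γ t)
  have hc0 : c 0 = w := by
    simp only [c, h0, linearChart_proj e i (insertAt_one_ne_zero i w)]
    simp
  have hc : ContDiffAt ℝ ∞ c 0 := ContMDiffAt.contDiffAt <|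
    (contMDiffAt_of_mem_maximalAtlas (linearChart_mem_maximalAtlas e i) hsrc).comp 0 hγ
  have hcF : ∀ᶠ t in 𝓝 0, c t ∈ realPart n := by
    filter_upwards [hL, hsrc'] with t ht ht'
    exact (mem_realProjective_iff e i ht').1 ht
  have hs : ContDiffAt ℝ ∞ (fun t => insertAt i 1 (c t)) 0 :=
    (contDiff_insertAt i 1).contDiffAt.comp 0 hc
  have hs' := (hs.differentiableAt (by simp)).hasDerivAt
  set a := deriv (fun t => insertAt i 1 (c t)) 0
  refine ⟨a, hs'.mem_of_eventually_mem (isClosed_realPart _) ?_, ?_⟩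
  · filter_upwards [hcF] with t ht
    exact insertAt_mem_realPart (by simp) ht
  let T : (Fin (n + 1) → ℂ) →L[ℝ] (Fin (n + 1) → ℂ) :=
    (e.toLinearMap.toContinuousLinearMap).restrictScalars ℝ
  have hT : HasDerivAt (fun t => e (insertAt i 1 (c t))) (e a) 0 :=
    T.hasFDerivAt.comp_hasDerivAt 0 hs'
  have hev : γ =ᶠ[𝓝 0] fun t => proj (e (insertAt i 1 (c t))) := by
    filter_upwards [hsrc'] with t ht
    rw [← linearChart_symm_apply, (linearChart e i).left_inv ht]
  have hproj := hasMFDerivAt_proj (hne w)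
  rw [← hc0] at hproj
  have hcomp := (hproj.comp (0 : ℝ) hT.hasFDerivAt.hasMFDerivAt).congr_of_eventuallyEq hev
  rw [hcomp.mfderiv] at h1
  rw [(hasMFDerivAt_proj (hne w)).mfderiv]
  refine h1.symm.trans ?_
  rw [hc0]
  change projDeriv _ _ ((1 : ℝ) • e a) = projDeriv _ _ (e a)
  rw [one_smul]

/-- If the hermitian product is real on the totally real subspace `e(ℝⁿ⁺¹)`, then its image in
`ℂℙⁿ` is Lagrangian for the Fubini-Study form. -/
theorem isLagrangianSubmanifold_realProjective (e : (Fin (n + 1) → ℂ) ≃ₗ[ℂ] (Fin (n + 1) → ℂ))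
    (he : ∀ x ∈ realPart (n + 1), ∀ y ∈ realPart (n + 1), (star (e x) ⬝ᵥ e y).im = 0) :
    IsLagrangianSubmanifold (fubiniStudy n) (realProjective e) where
  submanifold := by
    refine ⟨n, ?_, isEmbeddedSubmanifold_realProjective e⟩
    rw [Module.finrank_pi_fintype]
    simp [Complex.finrank_real_complex, mul_comm]
  isotropic := by
    rintro p hp u hu v hv
    -- Both tangent vectors must be lifted at one common real representative of `p`.
    obtain ⟨i, w, hw, rfl⟩ : ∃ i, ∃ w ∈ realPart n, p = proj (e (insertAt i 1 w)) := by
      obtain ⟨x, -, hx0, hpx⟩ := id hp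
      obtain ⟨i, hi⟩ : ∃ i, x i ≠ 0 := Function.ne_iff.1 hx0
      have hs : p ∈ (linearChart e i).source := hpx ▸ (mem_linearChart_source e i hx0).2 hi
      exact ⟨i, linearChart e i p, (mem_realProjective_iff e i hs).1 hp, by
        rw [← linearChart_symm_apply, (linearChart e i).left_inv hs]⟩
    obtain ⟨a, ha, rfl⟩ := exists_eq_mfderiv_proj_of_mem_tangentVectors e hu
    obtain ⟨b, hb, rfl⟩ := exists_eq_mfderiv_proj_of_mem_tangentVectors e hv
    have hz : insertAt i 1 w ∈ realPart (n + 1) := insertAt_mem_realPart (by simp) hw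
    -- Each term of the numerator contains a factor `Im h(a, b)`, `Im h(a, z)` or `Im h(z, b)`, all
    -- of them zero.
    rw [fubiniStudy_mfderiv_proj (e.map_ne_zero_iff.2 (insertAt_one_ne_zero i w)),
      homogeneousForm, stdSymplectic, Complex.mul_im, he a ha b hb, he a ha _ hz, he _ hz b hb]
    simp

end CP

/-! ### `𝓛₂` as a real projective plane -/

/-- The linear automorphism `(x₀, x₁, x₂) ↦ (x₀ - i x₁, i x₂, x₀ + i x₁)` of `ℂ³`. -/
noncomputable def lagFrame : (Fin 3 → ℂ) ≃ₗ[ℂ] (Fin 3 → ℂ) where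
  toFun x := ![x 0 - Complex.I * x 1, Complex.I * x 2, x 0 + Complex.I * x 1]
  invFun z := ![(z 0 + z 2) / 2, Complex.I * (z 0 - z 2) / 2, -Complex.I * z 1]
  map_add' x y := by
    funext k
    fin_cases k <;> simp <;> ring
  map_smul' c x := by
    funext k
    fin_cases k <;> simp <;> ring
  left_inv x := by
    funext k
    fin_cases k
    · simp
    · simp
      linear_combination (-x 1) * Complex.I_sq
    · simp
      linear_combination (-x 2) * Complex.I_sq
  right_inv z := by
    funext k
    fin_cases k
    · simp
      linear_combination (-(z 0 - z 2) / 2) * Complex.I_sq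
    · simp
      linear_combination (-z 1) * Complex.I_sq
    · simp
      linear_combination ((z 0 - z 2) / 2) * Complex.I_sq

lemma lagFrame_apply (x : Fin 3 → ℂ) :
    lagFrame x = ![x 0 - Complex.I * x 1, Complex.I * x 2, x 0 + Complex.I * x 1] := rfl

/-- For real `x` and `y` the first and last terms are complex conjugates, and the product equals `2
x₀ y₀ + 2 x₁ y₁ + x₂ y₂`. -/
lemma lagFrame_isotropic (x y : Fin 3 → ℂ) (hx : x ∈ CP.realPart 3) (hy : y ∈ CP.realPart 3) :
    (star (lagFrame x) ⬝ᵥ lagFrame y).im = 0 := by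
  rw [CP.mem_realPart] at hx hy
  simp only [lagFrame_apply, dotProduct, Fin.sum_univ_three]
  simp [hx, hy]
  ring

/-- Every `(w, t)` in the unit sphere of `ℂ × ℝ` is `(α² + β², 2 Im (ᾱ β))` for some unit vector
`(α, β)` of `ℂ²`. -/
lemma exists_lag_parameters {w : ℂ} {t : ℝ} (h : ‖w‖ ^ 2 + t ^ 2 = 1) :
    ∃ α β : ℂ, ‖α‖ ^ 2 + ‖β‖ ^ 2 = 1 ∧ α ^ 2 + β ^ 2 = w ∧
      2 * (starRingEnd ℂ α * β).im = t := by
  -- With `ξ = α + i β` and `η = α - i β`, the quantity `α² + β²` factors as `ξ η`, while `|ξ|²` and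
  -- `|η|²` are `|α|² + |β|² ∓ 2 Im (ᾱ β)`. The moduli are compatible because `|w|² = (1 - t)(1 +
  -- t)`.
  obtain ⟨ξ, η, h1, h2, h3⟩ : ∃ ξ η : ℂ, ξ * η = w ∧ ‖ξ‖ ^ 2 = 1 - t ∧ ‖η‖ ^ 2 = 1 + t := by
    have ht : 0 ≤ 1 - t := by nlinarith [sq_nonneg ‖w‖]
    rcases ht.eq_or_lt with ht | ht
    · obtain rfl : t = 1 := by linarith
      have hw : w = 0 := by simpa using h
      -- For `t = 1` the factor `ξ` is forced to be zero, and any `η` with `|η|² = 2` serves.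
      exact ⟨0, (√2 : ℝ), by simp [hw], by simp, by
        rw [Complex.norm_real, Real.norm_eq_abs, sq_abs, Real.sq_sqrt] <;> norm_num⟩
    · have hs : √(1 - t) ≠ 0 := (Real.sqrt_pos.2 ht).ne'
      have hsc : ((√(1 - t) : ℝ) : ℂ) ≠ 0 := Complex.ofReal_ne_zero.2 hs
      have hn : ‖((√(1 - t) : ℝ) : ℂ)‖ ^ 2 = 1 - t := by
        rw [Complex.norm_real, Real.norm_eq_abs, sq_abs, Real.sq_sqrt ht.le]
      refine ⟨(√(1 - t) : ℝ), w / (√(1 - t) : ℝ), by field_simp, hn, ?_⟩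
      rw [norm_div, div_pow, hn, div_eq_iff ht.ne']
      linarith
  -- Solve `ξ = α + i β`, `η = α - i β` for `α` and `β`.
  refine ⟨(ξ + η) / 2, Complex.I * (η - ξ) / 2, ?_, ?_, ?_⟩
  · rw [← Complex.normSq_eq_norm_sq] at h2 h3 ⊢
    rw [← Complex.normSq_eq_norm_sq]
    simp [Complex.normSq_apply] at h2 h3 ⊢
    linarith
  · rw [← h1]
    linear_combination ((η - ξ) ^ 2 / 4) * Complex.I_sq
  · rw [← Complex.normSq_eq_norm_sq] at h2 h3
    have hconj : starRingEnd ℂ 2 = 2 := Complex.conj_ofNat 2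
    simp [Complex.normSq_apply, hconj] at h2 h3 ⊢
    linarith

/-- The outer entries are conjugate to each other, and the middle one is purely imaginary since `ᾱ β
- α β̄ = 2 i Im (ᾱ β)`. -/
lemma lagVector_eq (α β : ℂ) :
    lagVector α β = lagFrame ![(((α ^ 2 + β ^ 2).re : ℝ) : ℂ), (((α ^ 2 + β ^ 2).im : ℝ) : ℂ),
      ((√2 * (2 * (starRingEnd ℂ α * β).im) : ℝ) : ℂ)] := by
  rw [lagFrame_apply]
  funext k
  fin_cases k
  · apply Complex.ext <;> simp [lagVector, pow_two] <;> ring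
  · apply Complex.ext <;> simp [lagVector] <;> ring
  · apply Complex.ext <;> simp [lagVector]

lemma lagL2_eq_realProjective : lagL2 = CP.realProjective lagFrame := by
  ext p
  constructor
  · rintro ⟨α, β, h, rfl⟩
    have h0 := lagVector_ne_zero h
    rw [← CP.proj_of_ne_zero h0]
    rw [lagVector_eq] at h0 ⊢
    refine ⟨_, ?_, lagFrame.map_ne_zero_iff.1 h0, rfl⟩
    intro k
    fin_cases k <;> simp
  · rintro ⟨x, hx, hx0, rfl⟩
    obtain ⟨y, rfl⟩ : ∃ y : Fin 3 → ℝ, x = fun k => (y k : ℂ) :=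
      ⟨fun k => (x k).re, funext fun k => Complex.ext (by simp) (by simpa using hx k)⟩
    have hr : 0 < y 0 ^ 2 + y 1 ^ 2 + y 2 ^ 2 / 2 := by
      by_contra hcon
      apply hx0
      have h0 : y 0 = 0 := by nlinarith [sq_nonneg (y 0), sq_nonneg (y 1), sq_nonneg (y 2)]
      have h1 : y 1 = 0 := by nlinarith [sq_nonneg (y 0), sq_nonneg (y 1), sq_nonneg (y 2)]
      have h2 : y 2 = 0 := by nlinarith [sq_nonneg (y 0), sq_nonneg (y 1), sq_nonneg (y 2)]
      funext k
      fin_cases k <;> simp [h0, h1, h2]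
    -- Dividing by `r` moves `y` onto the ellipsoid `y₀² + y₁² + y₂² / 2 = 1` traced out by the
    -- parametrization; the weight `1/2` comes from the factor `√2` in the third coordinate `√2 t`.
    set r := √(y 0 ^ 2 + y 1 ^ 2 + y 2 ^ 2 / 2) with hrdef
    have hr0 : r ≠ 0 := (Real.sqrt_pos.2 hr).ne'
    have hr2 : r ^ 2 = y 0 ^ 2 + y 1 ^ 2 + y 2 ^ 2 / 2 := Real.sq_sqrt hr.le
    have h2 : √2 ^ 2 = (2 : ℝ) := Real.sq_sqrt (by norm_num)
    have h2' : √2 ≠ (0 : ℝ) := by positivity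
    obtain ⟨α, β, h, hw, ht⟩ := exists_lag_parameters (w := ⟨y 0 / r, y 1 / r⟩)
      (t := y 2 / (√2 * r)) (by
        rw [← Complex.normSq_eq_norm_sq, Complex.normSq_apply]
        simp only [div_pow, mul_pow, h2]
        field_simp
        linarith)
    refine ⟨α, β, h, ?_⟩
    have hc : ((r⁻¹ : ℝ) : ℂ) ≠ 0 := Complex.ofReal_ne_zero.2 (inv_ne_zero hr0)
    -- Rescaling the representative by `r⁻¹` does not change the projective point, so it suffices to
    -- compare real vectors.
    rw [← CP.proj_of_ne_zero, lagVector_eq, hw, ht,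
      ← CP.proj_smul hc (lagFrame.map_ne_zero_iff.2 hx0), ← map_smul]
    congr 2
    funext k
    fin_cases k
    · simp [div_eq_inv_mul]
    · simp [div_eq_inv_mul]
    · have : √2 * (y 2 / (√2 * r)) = r⁻¹ * y 2 := by field_simp
      simp only [this]
      simp

theorem mainTheorem3 : IsLagrangianSubmanifold (CP.fubiniStudy 2) lagL2 := by
  rw [lagL2_eq_realProjective]
  exact CP.isLagrangianSubmanifold_realProjective lagFrame fun x hx y hy =>
    lagFrame_isotropic x y hx hy
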